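/- Let $k$ be a field and let $Q$ be a finite quiver (finitely many vertices and finitely many arrows). Let $kQ^a$ be its path algebra, that is, the $k$-vector space with basis all paths of $Q$ (including the trivial path $e_i$ at each vertex $i$), where the product of two paths is their concatenation if the first ends where the second starts, and $0$ otherwise. Let $\widehat{kQ^a}=\prod_{p}k$, the product being over all paths $p$ of $Q$, be the complete path algebra, with multiplication $(a_p)_p\cdot(b_p)_p=(c_p)_p$, $c_p=\sum_{p=p_1p_2}a_{p_1}b_{p_2}$. For $n\ge 0$ let $kQ^a_{\ge n}$ be the span of the paths of length at least $n$. Let $I$ be an admissible ideal of $kQ^a$, i.e. a two-sided ideal with $kQ^a_{\ge n}\subseteq I\subseteq kQ^a_{\ge 2}$ for some $n\ge 2$, and let $B=kQ^a/I$. For a $k$-algebra $A$ write $\operatorname{Aut}(A)$ for its group of $k$-algebra automorphisms. Then $\operatorname{Aut}(B)$ is a subquotient group of $\operatorname{Aut}(\widehat{kQ^a})$, i.e. there are a subgroup $H\le\operatorname{Aut}(\widehat{kQ^a})$ and a normal subgroup $N\lhd H$ with $\operatorname{Aut}(B)\cong H/N$. In particular, if $Q$ is acyclic (has no oriented cycles),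 then $\operatorname{Aut}(B)$ is a subquotient group of $\operatorname{Aut}(kQ^a)$. -/

import Mathlib

open Quiver

namespace PathAlg

universe u v w

section Splits

variable {V : Type u} [Quiver.{v} V]

/-- The set of all splits `p = p₁ p₂` of a path `p` as a concatenation of two paths
(`p₁` running from the source of `p` to some vertex `c`, and `p₂` from `c` to the target). -/
def splitSet {a b : V} (p : Path a b) : Set (Σ c : V, Path a c × Path c b) :=
  {x | x.2.1.comp x.2.2 = p}

theorem splitSet_finite {a b : V} (p : Path a b) : (splitSet p).Finite := by
  induction p with
  | nil =>
    refine (Set.finite_singleton (⟨a, Path.nil, Path.nil⟩ : Σ c : V, Path a c × Path c a)).subset ?_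
    rintro ⟨c, q, r⟩ h
    have h1 : q.comp r = Path.nil := h
    cases r with
    | nil => cases h1; rfl
    | cons r e => exact absurd h1 (Path.cons_ne_nil _ _)
  | @cons b d p e ih =>
    refine ((ih.image (fun x : Σ c : V, Path a c × Path c b =>
      (⟨x.1, x.2.1, x.2.2.cons e⟩ : Σ c : V, Path a c × Path c d))).union
      (Set.finite_singleton
        (⟨d, p.cons e, Path.nil⟩ : Σ c : V, Path a c × Path c d))).subset ?_
    rintro ⟨c, q, r⟩ h
    have h1 : q.comp r = p.cons e := h
    cases r with
    | nil =>
      right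
      cases h1
      rfl
    | cons r f =>
      left
      rw [Path.comp_cons] at h1
      cases h1
      exact ⟨⟨c, q, r⟩, rfl, rfl⟩

/-- The finite set of all splits of a path. -/
noncomputable def splits {a b : V} (p : Path a b) : Finset (Σ c : V, Path a c × Path c b) :=
  (splitSet_finite p).toFinset

theorem mem_splits {a b : V} {p : Path a b} {x : Σ c : V, Path a c × Path c b} :
    x ∈ splits p ↔ x.2.1.comp x.2.2 = p := by
  simp [splits, splitSet]

end Splits

/-- The complete path algebra of a quiver `V` over `k`: all families `(f_p)` of scalars indexed by
all paths `p` of the quiver, thought of as infinite linear combinations of paths. -/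
def CompletePathAlgebra (k : Type w) (V : Type u) [Quiver.{v} V] : Type (max u v w) :=
  ∀ a b : V, Path a b → k

namespace CompletePathAlgebra

variable {k : Type w} [CommRing k] {V : Type u} [Quiver.{v} V]

noncomputable instance : AddCommGroup (CompletePathAlgebra k V) :=
  inferInstanceAs (AddCommGroup (∀ a b : V, Path a b → k))

noncomputable instance : Module k (CompletePathAlgebra k V) :=
  inferInstanceAs (Module k (∀ a b : V, Path a b → k))

/-- The product `(f g)_p = ∑_{p = p₁ p₂} f_{p₁} g_{p₂}`. -/
noncomputable instance : Mul (CompletePathAlgebra k V) :=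
  ⟨fun f g a b p => ∑ x ∈ splits p, f a x.1 x.2.1 * g x.1 b x.2.2⟩

/-- The identity element is the sum of all trivial paths. -/
noncomputable instance : One (CompletePathAlgebra k V) :=
  ⟨fun _ _ p => if p.length = 0 then 1 else 0⟩

theorem add_apply (f g : CompletePathAlgebra k V) {a b : V} (p : Path a b) :
    (f + g) a b p = f a b p + g a b p := rfl

theorem zero_apply {a b : V} (p : Path a b) : (0 : CompletePathAlgebra k V) a b p = 0 := rfl

theorem smul_apply (c : k) (f : CompletePathAlgebra k V) {a b : V} (p : Path a b) :
    (c • f) a b p = c * f a b p := rfl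

theorem mul_apply (f g : CompletePathAlgebra k V) {a b : V} (p : Path a b) :
    (f * g) a b p = ∑ x ∈ splits p, f a x.1 x.2.1 * g x.1 b x.2.2 := rfl

theorem one_apply {a b : V} (p : Path a b) :
    (1 : CompletePathAlgebra k V) a b p = if p.length = 0 then 1 else 0 := rfl

theorem ext' {k : Type w} {V : Type u} [Quiver.{v} V] {f g : CompletePathAlgebra k V}
    (h : ∀ (a b : V) (p : Path a b), f a b p = g a b p) :
    f = g :=
  funext fun a => funext fun b => funext fun p => h a b p

protected theorem one_mul' (f : CompletePathAlgebra k V) : 1 * f = f := by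
  refine ext' fun a b p => ?_
  rw [mul_apply, Finset.sum_eq_single (⟨a, Path.nil, p⟩ : Σ c : V, Path a c × Path c b)]
  · simp [one_apply]
  · rintro ⟨c, q, r⟩ hx hne
    have h1 : q.comp r = p := mem_splits.1 hx
    rw [one_apply, if_neg, zero_mul]
    intro h0
    obtain rfl := Path.eq_of_length_zero q h0
    obtain rfl := Path.eq_nil_of_length_zero q h0
    rw [Path.nil_comp] at h1
    exact hne (by rw [h1])
  · intro h
    exact absurd (mem_splits.2 (Path.nil_comp p)) h

protected theorem mul_one' (f : CompletePathAlgebra k V) : f * 1 = f := by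
  refine ext' fun a b p => ?_
  rw [mul_apply, Finset.sum_eq_single (⟨b, p, Path.nil⟩ : Σ c : V, Path a c × Path c b)]
  · simp [one_apply]
  · rintro ⟨c, q, r⟩ hx hne
    have h1 : q.comp r = p := mem_splits.1 hx
    rw [one_apply, if_neg, mul_zero]
    intro h0
    obtain rfl := Path.eq_of_length_zero r h0
    obtain rfl := Path.eq_nil_of_length_zero r h0
    rw [Path.comp_nil] at h1
    exact hne (by rw [h1])
  · intro h
    exact absurd (mem_splits.2 (Path.comp_nil p)) h

protected theorem mul_assoc' (f g h : CompletePathAlgebra k V) : f * g * h = f * (g * h) := by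
  refine ext' fun a b p => ?_
  simp only [mul_apply, Finset.sum_mul, Finset.mul_sum]
  rw [Finset.sum_sigma', Finset.sum_sigma']
  have key₁ : ∀ {c d : V} (q : Path a c) (s : Path a d) (t : Path d c) (r : Path c b),
      s.comp t = q →
      (⟨⟨c, s.comp t, r⟩, ⟨d, s, t⟩⟩ :
        Σ x : (Σ c : V, Path a c × Path c b), Σ d : V, Path a d × Path d x.1) =
      ⟨⟨c, q, r⟩, ⟨d, s, t⟩⟩ := by
    rintro c d q s t r rfl
    rfl
  have key₂ : ∀ {c d : V} (q : Path a c) (r : Path c b) (s : Path c d) (t : Path d b),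
      s.comp t = r →
      (⟨⟨c, q, s.comp t⟩, ⟨d, s, t⟩⟩ :
        Σ x : (Σ c : V, Path a c × Path c b), Σ d : V, Path x.1 d × Path d b) =
      ⟨⟨c, q, r⟩, ⟨d, s, t⟩⟩ := by
    rintro c d q r s t rfl
    rfl
  refine Finset.sum_bij'
    (fun x _ => ⟨⟨x.2.1, x.2.2.1, x.2.2.2.comp x.1.2.2⟩, ⟨x.1.1, x.2.2.2, x.1.2.2⟩⟩)
    (fun x _ => ⟨⟨x.2.1, x.1.2.1.comp x.2.2.1, x.2.2.2⟩, ⟨x.1.1, x.1.2.1, x.2.2.1⟩⟩)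
    ?_ ?_ ?_ ?_ ?_
  · rintro ⟨⟨c, q, r⟩, ⟨d, s, t⟩⟩ hx
    simp only [Finset.mem_sigma, mem_splits] at hx ⊢
    obtain ⟨h1, h2⟩ := hx
    exact ⟨by rw [← Path.comp_assoc, h2, h1], trivial⟩
  · rintro ⟨⟨c, q, r⟩, ⟨d, s, t⟩⟩ hx
    simp only [Finset.mem_sigma, mem_splits] at hx ⊢
    obtain ⟨h1, h2⟩ := hx
    exact ⟨by rw [Path.comp_assoc, h2, h1], trivial⟩
  · rintro ⟨⟨c, q, r⟩, ⟨d, s, t⟩⟩ hx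
    exact key₁ q s t r (mem_splits.1 (Finset.mem_sigma.1 hx).2)
  · rintro ⟨⟨c, q, r⟩, ⟨d, s, t⟩⟩ hx
    exact key₂ q r s t (mem_splits.1 (Finset.mem_sigma.1 hx).2)
  · rintro ⟨⟨c, q, r⟩, ⟨d, s, t⟩⟩ _
    exact mul_assoc _ _ _

noncomputable instance : Ring (CompletePathAlgebra k V) :=
  { (inferInstance : AddCommGroup (CompletePathAlgebra k V)),
    (inferInstance : Mul (CompletePathAlgebra k V)),
    (inferInstance : One (CompletePathAlgebra k V)) with
    one_mul := CompletePathAlgebra.one_mul'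
    mul_one := CompletePathAlgebra.mul_one'
    mul_assoc := CompletePathAlgebra.mul_assoc'
    zero_mul := fun f => ext' fun a b p => by
      simp [mul_apply, zero_apply]
    mul_zero := fun f => ext' fun a b p => by
      simp [mul_apply, zero_apply]
    left_distrib := fun f g h => ext' fun a b p => by
      simp only [mul_apply, add_apply, mul_add, Finset.sum_add_distrib]
    right_distrib := fun f g h => ext' fun a b p => by
      simp only [mul_apply, add_apply, add_mul, Finset.sum_add_distrib] }

noncomputable instance : Algebra k (CompletePathAlgebra k V) :=
  Algebra.ofModule
    (fun c f g => ext' fun a b p => by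
      simp only [mul_apply, smul_apply, Finset.mul_sum, mul_assoc])
    (fun c f g => ext' fun a b p => by
      simp only [mul_apply, smul_apply, Finset.mul_sum, mul_left_comm])

/-- The set of paths that occur in `f` with a nonzero coefficient. -/
def support (f : CompletePathAlgebra k V) : Set (Σ a b : V, Path a b) :=
  {x | f x.1 x.2.1 x.2.2 ≠ 0}

theorem support_mul_finite {f g : CompletePathAlgebra k V} (hf : f.support.Finite)
    (hg : g.support.Finite) : (f * g).support.Finite := by
  classical
  let F : (Σ a b : V, Path a b) × (Σ a b : V, Path a b) → (Σ a b : V, Path a b) := fun z =>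
    if h : z.1.2.1 = z.2.1 then ⟨z.1.1, z.2.2.1, (h ▸ z.1.2.2).comp z.2.2.2⟩ else z.1
  refine ((hf.prod hg).image F).subset ?_
  rintro ⟨a, b, p⟩ hp
  have hp' : ∑ x ∈ splits p, f a x.1 x.2.1 * g x.1 b x.2.2 ≠ 0 := hp
  obtain ⟨⟨c, q, r⟩, hx, hne⟩ := Finset.exists_ne_zero_of_sum_ne_zero hp'
  have h1 : q.comp r = p := mem_splits.1 hx
  refine ⟨(⟨a, c, q⟩, ⟨c, b, r⟩), ⟨left_ne_zero_of_mul hne, right_ne_zero_of_mul hne⟩, ?_⟩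
  simp [F, h1]

end CompletePathAlgebra

/-- The path algebra of a quiver `V` with finitely many vertices over `k`: the `k`-space of all
finite linear combinations of paths, with the product induced by concatenation of paths (the product
of two paths is zero if they cannot be concatenated), realised inside the complete path algebra. -/
noncomputable def pathSubalgebra (k : Type w) [CommRing k] (V : Type u) [Quiver.{v} V] [Finite V] :
    Subalgebra k (CompletePathAlgebra k V) where
  carrier := {f | f.support.Finite}
  mul_mem' hf hg := CompletePathAlgebra.support_mul_finite hf hg
  add_mem' {f g} hf hg := by
    refine (Set.Finite.union hf hg).subset ?_
    rintro ⟨a, b, p⟩ hp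
    by_contra hcon
    simp only [Set.mem_union, CompletePathAlgebra.support, Set.mem_ofPred_eq, not_or, not_not] at hcon
    exact hp (by
      change f a b p + g a b p = 0
      rw [hcon.1, hcon.2, add_zero])
  algebraMap_mem' c := by
    refine (Set.finite_range
      (fun a : V => (⟨a, a, Path.nil⟩ : Σ a b : V, Path a b))).subset ?_
    rintro ⟨a, b, p⟩ hp
    have hp' : (c • (1 : CompletePathAlgebra k V)) a b p ≠ 0 := by
      rw [← Algebra.algebraMap_eq_smul_one]
      exact hp
    rw [CompletePathAlgebra.smul_apply, CompletePathAlgebra.one_apply] at hp'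
    have h0 : p.length = 0 := by
      by_contra h
      simp [h] at hp'
    obtain rfl := Path.eq_of_length_zero p h0
    obtain rfl := Path.eq_nil_of_length_zero p h0
    exact ⟨a, rfl⟩

/-- The path algebra of a quiver with finitely many vertices, as a type. -/
abbrev PathAlgebra (k : Type w) [CommRing k] (V : Type u) [Quiver.{v} V] [Finite V] :
    Type (max u v w) :=
  pathSubalgebra k V

/-- `f` is a linear combination of paths of length at least `n`. -/
def LengthGE {k : Type w} [CommRing k] {V : Type u} [Quiver.{v} V] [Finite V]
    (n : ℕ) (f : PathAlgebra k V) : Prop :=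
  ∀ (a b : V) (p : Path a b), p.length < n → (f : CompletePathAlgebra k V) a b p = 0

/-- An ideal `I` of the path algebra is admissible if, for some `n ≥ 2`, it contains all linear
combinations of paths of length at least `n`, and consists of linear combinations of paths of
length at least `2`. (Used for two-sided ideals.) -/
def IsAdmissible {k : Type w} [CommRing k] {V : Type u} [Quiver.{v} V] [Finite V]
    (I : Ideal (PathAlgebra k V)) : Prop :=
  ∃ n : ℕ, 2 ≤ n ∧ (∀ f : PathAlgebra k V, LengthGE n f → f ∈ I) ∧ ∀ f ∈ I, LengthGE 2 f

/-- A quiver is acyclic if it has no oriented cycle: every path from a vertex to itself is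
trivial. -/
def IsAcyclic (V : Type u) [Quiver.{v} V] : Prop :=
  ∀ (a : V) (p : Path a a), p.length = 0

/-- `G` is a subquotient group of `H`: it is isomorphic to a quotient of a subgroup of `H`. -/
def IsSubquotient (G : Type u) [Group G] (H : Type v) [Group H] : Prop :=
  ∃ (K : Subgroup H) (N : Subgroup K) (_ : N.Normal), Nonempty (G ≃* K ⧸ N)

end PathAlg

/-!
Let `B` be the quotient of the path algebra by an admissible ideal. Truncating long paths makes `B`
a quotient of the complete path algebra by a projection `π` (`quotientMap`) which kills the paths of
length at least some `n`, and whose kernel consists of combinations of paths of length at least `2`.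
The automorphisms of the complete path algebra that descend to `B` form a subgroup mapping to
`Aut B`, so the theorem follows once every automorphism `σ` of `B` is shown to lift
(`exists_algEquiv_lift`, `isSubquotient_of_forall_exists_lift`).

Lifting `σ` as an endomorphism (`exists_algHom_lift`) needs images of the trivial paths and of the
arrows. The idempotents `σ (π eᵢ)` lift to complete orthogonal idempotents `fᵢ`, because arbitrary
lifts can be corrected by conjugation with a unit
(`exists_completeOrthogonalIdempotents_lift`). Each `σ (π α)` is nilpotent, so its lifts have no
constant term, and the universal property of the complete path algebra (`exists_algHom_eval`)
produces the endomorphism.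

A lift of the identity of `B` moves each element by a combination of paths of length at least `2`,
so it is the identity on the graded module associated to the length filtration, hence bijective by
completeness (`bijective_of_sub_mem`, `bijective_of_lift_id`). Applied to the two composites of a
lift of `σ` with a lift of `σ⁻¹`, this shows that lifts of automorphisms are automorphisms.

Elements are handled through their constant coefficients and their right derivatives along the
arrows, which determine them and satisfy a Leibniz-type rule; this turns statements about
sums over all paths into recursions on path length.

If the quiver is acyclic, it has only finitely many paths, so the path algebra is the whole complete
path algebra.
-/

namespace PathAlg

universe u v w

/-! ### Arrows, constant coefficients and right derivatives -/

/-- The type of all arrows of a quiver. -/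
abbrev Arrow (V : Type u) [Quiver.{v} V] : Type (max u v) := Σ a b : V, (a ⟶ b)

namespace CompletePathAlgebra

section Basic

variable {k : Type w} [CommRing k] {V : Type u} [Quiver.{v} V]

theorem splits_nil (a : V) :
    splits (Path.nil : Path a a) = {⟨a, Path.nil, Path.nil⟩} := by
  ext ⟨c, q, r⟩
  rw [mem_splits, Finset.mem_singleton]
  constructor
  · intro h
    cases r with
    | nil => cases h; rfl
    | cons r e => exact absurd h (Path.cons_ne_nil _ _)
  · intro h
    cases h
    rfl

/-- A split of `p.cons e` either has a trivial second factor, or arises from a split of `p` by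
extending the second factor by `e`. -/
theorem sum_splits_cons {M : Type*} [AddCommMonoid M] {a b d : V} (p : Path a b) (e : b ⟶ d)
    (F : (Σ c : V, Path a c × Path c d) → M) :
    ∑ x ∈ splits (p.cons e), F x =
      F ⟨d, p.cons e, Path.nil⟩ + ∑ x ∈ splits p, F ⟨x.1, x.2.1, x.2.2.cons e⟩ := by
  classical
  have hs : splits (p.cons e) = insert ⟨d, p.cons e, Path.nil⟩ ((splits p).image
      fun x => (⟨x.1, x.2.1, x.2.2.cons e⟩ : Σ c : V, Path a c × Path c d)) := by
    ext ⟨c, q, r⟩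
    simp only [mem_splits, Finset.mem_insert, Finset.mem_image]
    constructor
    · intro h
      cases r with
      | nil => left; cases h; rfl
      | cons r f =>
        right
        rw [Path.comp_cons] at h
        cases h
        exact ⟨⟨c, q, r⟩, rfl, rfl⟩
    · rintro (h | ⟨⟨c', q', r'⟩, h, h'⟩)
      · cases h; rfl
      · cases h'
        rw [Path.comp_cons]
        exact congrArg (fun t => Path.cons t e) h
  rw [hs, Finset.sum_insert, Finset.sum_image]
  · rintro ⟨c, q, r⟩ _ ⟨c', q', r'⟩ _ h
    cases h
    rfl
  · simp only [Finset.mem_image, not_exists, not_and]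
    rintro ⟨c, q, r⟩ _ h
    have h1 := congrArg (fun x : (Σ c : V, Path a c × Path c d) => x.2.2.length) h
    simp at h1

/-- The coefficient at the trivial path of a vertex, as an algebra homomorphism. -/
noncomputable def constCoeff (i : V) : CompletePathAlgebra k V →ₐ[k] k :=
  AlgHom.ofLinearMap
    { toFun := fun f => f i i Path.nil
      map_add' := fun _ _ => rfl
      map_smul' := fun _ _ => rfl }
    (by
      change (1 : CompletePathAlgebra k V) i i Path.nil = 1
      simp [one_apply])
    (by
      intro f g
      change (f * g) i i Path.nil = f i i Path.nil * g i i Path.nil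
      rw [mul_apply, splits_nil, Finset.sum_singleton])

theorem constCoeff_apply (i : V) (f : CompletePathAlgebra k V) :
    constCoeff i f = f i i Path.nil := rfl

open Classical in
/-- The right derivative of `f` along an arrow `α`: its coefficient at a path `p` is the coefficient
of `f` at `p` followed by `α`, and `0` if `p` does not end at the source of `α`. Thus `f` is the
sum of its constant part and of all the products `rightDeriv α f * α`. -/
noncomputable def rightDeriv (α : Arrow V) :
    CompletePathAlgebra k V →ₗ[k] CompletePathAlgebra k V where
  toFun f := fun a b p =>
    if h : b = α.1 then f a α.2.1 (Path.cons (h ▸ p : Path a α.1) α.2.2) else 0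
  map_add' f g := ext' fun a b p => by
    change (if h : b = α.1 then (f + g) a α.2.1 (Path.cons (h ▸ p : Path a α.1) α.2.2) else 0) =
      (if h : b = α.1 then f a α.2.1 (Path.cons (h ▸ p : Path a α.1) α.2.2) else 0) +
      (if h : b = α.1 then g a α.2.1 (Path.cons (h ▸ p : Path a α.1) α.2.2) else 0)
    split_ifs
    · rfl
    · exact (add_zero 0).symm
  map_smul' c f := ext' fun a b p => by
    change (if h : b = α.1 then (c • f) a α.2.1 (Path.cons (h ▸ p : Path a α.1) α.2.2) else 0) =
      c * (if h : b = α.1 then f a α.2.1 (Path.cons (h ▸ p : Path a α.1) α.2.2) else 0)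
    split_ifs
    · rfl
    · exact (mul_zero c).symm

theorem rightDeriv_apply_same {a b d : V} (e : b ⟶ d) (f : CompletePathAlgebra k V)
    (p : Path a b) : rightDeriv ⟨b, d, e⟩ f a b p = f a d (p.cons e) :=
  dif_pos rfl

theorem rightDeriv_apply_of_ne {α : Arrow V} {a b : V} (h : b ≠ α.1)
    (f : CompletePathAlgebra k V) (p : Path a b) : rightDeriv α f a b p = 0 :=
  dif_neg h

theorem ext_rightDeriv {f g : CompletePathAlgebra k V}
    (h₀ : ∀ i, constCoeff i f = constCoeff i g) (h₁ : ∀ α, rightDeriv α f = rightDeriv α g) :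
    f = g := by
  refine ext' fun a b p => ?_
  cases p with
  | nil => exact h₀ a
  | cons p e => rw [← rightDeriv_apply_same e f, h₁, rightDeriv_apply_same]

/-- The Leibniz-type rule for right derivatives. -/
theorem rightDeriv_mul (α : Arrow V) (f g : CompletePathAlgebra k V) :
    rightDeriv α (f * g) = f * rightDeriv α g + constCoeff α.2.1 g • rightDeriv α f := by
  obtain ⟨i, j, e⟩ := α
  refine ext' fun a b p => ?_
  rw [add_apply, smul_apply, mul_apply]
  by_cases h : b = i
  · subst h
    simp only [rightDeriv_apply_same]
    rw [mul_apply, sum_splits_cons, add_comm, constCoeff_apply, mul_comm (f a j (p.cons e))]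
  · simp [rightDeriv_apply_of_ne (α := ⟨i, j, e⟩) h]

/-- The element with coefficients `c` at the trivial paths and `0` elsewhere. -/
noncomputable def diag (c : V → k) : CompletePathAlgebra k V :=
  fun a _ p => if p.length = 0 then c a else 0

@[simp] theorem constCoeff_diag (i : V) (c : V → k) : constCoeff i (diag c) = c i := by
  simp [constCoeff_apply, diag]

@[simp] theorem rightDeriv_diag (α : Arrow V) (c : V → k) : rightDeriv α (diag c) = 0 := by
  obtain ⟨i, j, e⟩ := α
  refine ext' fun a b p => ?_
  rw [zero_apply]
  by_cases h : b = i
  · subst h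
    rw [rightDeriv_apply_same]
    simp [diag]
  · exact rightDeriv_apply_of_ne (α := ⟨i, j, e⟩) h _ _

theorem diag_mul (c d : V → k) : diag c * diag d = diag (c * d) := by
  refine ext_rightDeriv (fun i => by simp) fun α => by simp [rightDeriv_mul]

theorem diag_one : diag (1 : V → k) = 1 := rfl

@[simp] theorem rightDeriv_one (α : Arrow V) :
    rightDeriv α (1 : CompletePathAlgebra k V) = 0 := by
  rw [← diag_one, rightDeriv_diag]

theorem diag_zero : diag (0 : V → k) = 0 :=
  ext_rightDeriv (fun i => by simp) fun α => by simp

open Classical in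
/-- The trivial path at a vertex, as an element of the complete path algebra. -/
noncomputable def vertex (i : V) : CompletePathAlgebra k V := diag (Pi.single i 1)

open Classical in
/-- An arrow, as an element of the complete path algebra. -/
noncomputable def arrow (α : Arrow V) : CompletePathAlgebra k V :=
  fun a b p => if (⟨a, b, p⟩ : Σ a b : V, Path a b) = ⟨α.1, α.2.1, α.2.2.toPath⟩ then 1 else 0

theorem constCoeff_arrow (i : V) (α : Arrow V) :
    constCoeff i (arrow α : CompletePathAlgebra k V) = 0 := by
  rw [constCoeff_apply, arrow, if_neg]
  intro h
  have := congrArg (fun x : (Σ a b : V, Path a b) => x.2.2.length) h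
  simp at this

open Classical in
theorem rightDeriv_arrow (α β : Arrow V) :
    rightDeriv β (arrow α : CompletePathAlgebra k V) = if α = β then vertex α.1 else 0 := by
  obtain ⟨i, j, e⟩ := β
  obtain ⟨i', j', e'⟩ := α
  refine ext' fun a b p => ?_
  by_cases h : b = i
  · subst h
    rw [rightDeriv_apply_same]
    cases p with
    | nil =>
      by_cases hh : (⟨i', j', e'⟩ : Arrow V) = ⟨a, j, e⟩
      · cases hh
        simp [arrow, vertex, diag, Hom.toPath]
      · rw [if_neg hh, arrow, if_neg, zero_apply]
        intro h
        apply hh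
        simp only [Hom.toPath] at h
        cases h
        rfl
    | cons p f =>
      have hz : (arrow ⟨i', j', e'⟩ : CompletePathAlgebra k V) a j ((p.cons f).cons e) = 0 := by
        rw [arrow, if_neg]
        intro h
        have := congrArg (fun x : (Σ a b : V, Path a b) => x.2.2.length) h
        simp at this
      rw [hz]
      split_ifs
      · simp [vertex, diag]
      · rfl
  · rw [rightDeriv_apply_of_ne (α := ⟨i, j, e⟩) h]
    split_ifs with hh
    · cases hh
      simp only [vertex, diag]
      split_ifs with h0
      · obtain rfl := Path.eq_of_length_zero p h0
        simp [h]
      · rfl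
    · rfl

/-- Elements supported on paths ending at `i` are fixed by right multiplication with `vertex i`. -/
theorem mul_vertex_eq_self {f : CompletePathAlgebra k V} {i : V}
    (h : ∀ (a b : V) (p : Path a b), b ≠ i → f a b p = 0) : f * vertex i = f := by
  refine ext_rightDeriv (fun j => ?_) fun α => ?_
  · by_cases hj : j = i
    · subst hj
      simp [vertex]
    · have : constCoeff j f = 0 := h _ _ _ hj
      simp [this]
  · rw [rightDeriv_mul, vertex, rightDeriv_diag, mul_zero, zero_add, constCoeff_diag]
    by_cases hj : α.2.1 = i
    · subst hj
      simp
    · obtain ⟨s, t, e⟩ := α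
      have hz : rightDeriv ⟨s, t, e⟩ f = 0 := by
        refine ext' fun a b p => ?_
        by_cases hb : b = s
        · subst hb
          rw [rightDeriv_apply_same, h _ _ _ hj]
          rfl
        · exact rightDeriv_apply_of_ne (α := ⟨s, t, e⟩) hb _ _
      rw [hz, smul_zero]

theorem arrow_mul_vertex (α : Arrow V) :
    (arrow α : CompletePathAlgebra k V) * vertex α.2.1 = arrow α := by
  refine mul_vertex_eq_self fun a b p hb => ?_
  rw [arrow, if_neg]
  intro h
  exact hb (congrArg (fun x : (Σ a b : V, Path a b) => x.2.1) h)

theorem rightDeriv_mul_vertex (α : Arrow V) (f : CompletePathAlgebra k V) :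
    rightDeriv α f * vertex α.1 = rightDeriv α f :=
  mul_vertex_eq_self fun _ _ _ hb => rightDeriv_apply_of_ne hb _ _

theorem completeOrthogonalIdempotents_vertex [Fintype V] :
    CompleteOrthogonalIdempotents (vertex : V → CompletePathAlgebra k V) where
  idem i := by
    classical
    rw [IsIdempotentElem, vertex, diag_mul, ← Pi.single_mul, mul_one]
  ortho i j hij := by
    change vertex i * vertex j = 0
    rw [vertex, vertex, diag_mul, ← diag_zero]
    congr 1
    ext v
    by_cases h : v = i
    · subst h; simp [hij]
    · simp [Pi.single_apply, h]
  complete := by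
    classical
    refine ext_rightDeriv (fun i => ?_) fun α => ?_
    · simp [map_sum, vertex, Pi.single_apply]
    · rw [map_sum, rightDeriv_one]
      exact Finset.sum_eq_zero fun i _ => rightDeriv_diag _ _

/-- Every element is the sum of its constant part and of its right derivatives times the
corresponding arrows. -/
theorem eq_sum_rightDeriv_mul_arrow [Fintype V] [Fintype (Arrow V)]
    (f : CompletePathAlgebra k V) :
    f = ∑ i, constCoeff i f • vertex i + ∑ α, rightDeriv α f * arrow α := by
  classical
  refine ext_rightDeriv (fun j => ?_) fun β => ?_
  · simp [map_sum, vertex, Pi.single_apply, constCoeff_arrow]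
  · simp only [map_add, map_sum, map_smul, rightDeriv_mul, constCoeff_arrow, zero_smul, add_zero,
      rightDeriv_arrow]
    simp only [vertex, rightDeriv_diag, smul_zero, Finset.sum_const_zero, zero_add, mul_ite,
      mul_zero, Finset.sum_ite_eq', Finset.mem_univ, if_true]
    exact (rightDeriv_mul_vertex β f).symm

/-! ### The filtration by path length -/

variable (k V) in
/-- The elements all of whose paths have length at least `n`. -/
def lengthFiltration (n : ℕ) : Submodule k (CompletePathAlgebra k V) where
  carrier := {f | ∀ (a b : V) (p : Path a b), p.length < n → f a b p = 0}
  add_mem' hf hg a b p hp := by rw [add_apply, hf a b p hp, hg a b p hp, add_zero]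
  zero_mem' _ _ _ _ := rfl
  smul_mem' c f hf a b p hp := by rw [smul_apply, hf a b p hp, mul_zero]

theorem mem_lengthFiltration_zero (f : CompletePathAlgebra k V) : f ∈ lengthFiltration k V 0 :=
  fun _ _ _ hp => absurd hp (Nat.not_lt_zero _)

theorem lengthFiltration_antitone : Antitone (lengthFiltration k V) :=
  fun _ _ h _ hf a b p hp => hf a b p (hp.trans_le h)

theorem mul_mem_lengthFiltration {m n : ℕ} {f g : CompletePathAlgebra k V}
    (hf : f ∈ lengthFiltration k V m) (hg : g ∈ lengthFiltration k V n) :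
    f * g ∈ lengthFiltration k V (m + n) := by
  intro a b p hp
  rw [mul_apply]
  refine Finset.sum_eq_zero ?_
  rintro ⟨c, q, r⟩ hx
  have hlen : q.length + r.length = p.length := by
    rw [← Path.length_comp, mem_splits.1 hx]
  rcases lt_or_ge q.length m with h | h
  · rw [hf a c q h, zero_mul]
  · rw [hg c b r (by omega), mul_zero]

theorem pow_mem_lengthFiltration {f : CompletePathAlgebra k V} (hf : f ∈ lengthFiltration k V 1)
    (n : ℕ) : f ^ n ∈ lengthFiltration k V n := by
  induction n with
  | zero => exact mem_lengthFiltration_zero _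
  | succ n ih => exact pow_succ f n ▸ mul_mem_lengthFiltration ih hf

theorem mem_lengthFiltration_one {f : CompletePathAlgebra k V} :
    f ∈ lengthFiltration k V 1 ↔ ∀ i, constCoeff i f = 0 := by
  refine ⟨fun h i => h i i Path.nil (by simp), fun h a b p hp => ?_⟩
  cases p with
  | nil => exact h a
  | cons p e => simp at hp

theorem rightDeriv_mem_lengthFiltration {n : ℕ} {f : CompletePathAlgebra k V}
    (hf : f ∈ lengthFiltration k V (n + 1)) (α : Arrow V) :
    rightDeriv α f ∈ lengthFiltration k V n := by
  obtain ⟨i, j, e⟩ := α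
  intro a b p hp
  by_cases h : b = i
  · subst h
    rw [rightDeriv_apply_same]
    exact hf _ _ _ (by simpa using hp)
  · exact rightDeriv_apply_of_ne (α := ⟨i, j, e⟩) h _ _

theorem arrow_mem_lengthFiltration (α : Arrow V) :
    (arrow α : CompletePathAlgebra k V) ∈ lengthFiltration k V 1 :=
  mem_lengthFiltration_one.2 fun i => constCoeff_arrow i α

theorem eq_zero_of_forall_mem_lengthFiltration {f : CompletePathAlgebra k V}
    (h : ∀ n, f ∈ lengthFiltration k V n) : f = 0 :=
  ext' fun a b p => h (p.length + 1) a b p (Nat.lt_succ_self _)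

/-- Completeness: a sequence whose successive differences are longer and longer converges. -/
theorem exists_limit (s : ℕ → CompletePathAlgebra k V)
    (hs : ∀ n, s (n + 1) - s n ∈ lengthFiltration k V n) :
    ∃ g, ∀ n, g - s n ∈ lengthFiltration k V n := by
  refine ⟨fun a b p => s (p.length + 1) a b p, fun n a b p hp => ?_⟩
  have key : ∀ m, s (p.length + 1 + m) a b p = s (p.length + 1) a b p := by
    intro m
    induction m with
    | zero => rfl
    | succ m ih =>
      rw [← ih, ← sub_eq_zero]
      exact hs (p.length + 1 + m) a b p (by omega)
  have := key (n - (p.length + 1))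
  rw [Nat.add_sub_cancel' hp] at this
  exact sub_eq_zero.2 this.symm

/-- An additive map that is the identity on the associated graded module is bijective. -/
theorem bijective_of_sub_mem (θ : CompletePathAlgebra k V →+ CompletePathAlgebra k V)
    (hθ : ∀ n, ∀ f ∈ lengthFiltration k V n, θ f - f ∈ lengthFiltration k V (n + 1)) :
    Function.Bijective θ := by
  constructor
  · refine (injective_iff_map_eq_zero θ).2 fun f hf => ?_
    refine eq_zero_of_forall_mem_lengthFiltration fun n => ?_
    induction n with
    | zero => exact mem_lengthFiltration_zero _
    | succ n ih =>
      have := hθ n f ih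
      rwa [hf, zero_sub, Submodule.neg_mem_iff] at this
  · intro y
    -- the fixed point of `x ↦ y - (θ x - x)` is the limit of its iterates
    obtain ⟨s, hs0⟩ : ∃ s : ℕ → CompletePathAlgebra k V,
        ∀ n, s (n + 1) = y - (θ (s n) - s n) :=
      ⟨fun n => Nat.rec y (fun _ x => y - (θ x - x)) n, fun n => rfl⟩
    have hs : ∀ n, s (n + 1) - s n ∈ lengthFiltration k V n := by
      intro n
      induction n with
      | zero => exact mem_lengthFiltration_zero _
      | succ n ih =>
        have h1 : s (n + 1 + 1) - s (n + 1) = -(θ (s (n + 1) - s n) - (s (n + 1) - s n)) := by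
          have hy : y = s (n + 1) + (θ (s n) - s n) := by rw [hs0 n]; abel
          rw [hs0 (n + 1), map_sub]
          nth_rewrite 1 [hy]
          abel
        rw [h1]
        exact neg_mem (hθ n _ ih)
    obtain ⟨x, hx⟩ := exists_limit s hs
    refine ⟨x, sub_eq_zero.1 (eq_zero_of_forall_mem_lengthFiltration fun n => ?_)⟩
    have h1 : θ x - y = (θ (x - s n) - (x - s n)) + (x - s (n + 1)) := by
      rw [hs0, map_sub]
      abel
    rw [h1]
    exact add_mem (lengthFiltration_antitone (Nat.le_succ n) (hθ n _ (hx n)))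
      (lengthFiltration_antitone (Nat.le_succ n) (hx (n + 1)))

theorem isUnit_of_sub_one_mem {u : CompletePathAlgebra k V}
    (hu : u - 1 ∈ lengthFiltration k V 1) : IsUnit u := by
  have hl : Function.Bijective (AddMonoidHom.mulLeft u) := bijective_of_sub_mem _ fun n f hf => by
    have h := mul_mem_lengthFiltration hu hf
    rwa [sub_mul, one_mul, add_comm] at h
  have hr : Function.Bijective (AddMonoidHom.mulRight u) := bijective_of_sub_mem _ fun n f hf => by
    have h := mul_mem_lengthFiltration hf hu
    rwa [mul_sub, mul_one] at h
  obtain ⟨v, hv⟩ := hl.2 1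
  obtain ⟨v', hv'⟩ := hr.2 1
  exact isUnit_iff_exists_and_exists.2 ⟨⟨v, hv⟩, ⟨v', hv'⟩⟩

end Basic
/-! ### Homomorphisms out of the complete path algebra -/

section Hom

variable {k : Type w} [CommRing k] {V : Type u} [Quiver.{v} V] [Fintype V] [Fintype (Arrow V)]

/-- The approximations, by recursion on path length, of the map sending the trivial path at `i` to
`f i` and the arrow `α` to `x α`: the `n`-th one discards the paths of length at least `n`. -/
noncomputable def evalApprox (f : V → CompletePathAlgebra k V)
    (x : Arrow V → CompletePathAlgebra k V) :
    ℕ → CompletePathAlgebra k V →ₗ[k] CompletePathAlgebra k V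
  | 0 => 0
  | n + 1 => ∑ i, (constCoeff i).toLinearMap.smulRight (f i) +
      ∑ α, LinearMap.mulRight k (x α) ∘ₗ evalApprox f x n ∘ₗ rightDeriv α

theorem evalApprox_succ (f : V → CompletePathAlgebra k V)
    (x : Arrow V → CompletePathAlgebra k V) (n : ℕ) (h : CompletePathAlgebra k V) :
    evalApprox f x (n + 1) h =
      ∑ i, constCoeff i h • f i + ∑ α, evalApprox f x n (rightDeriv α h) * x α := by
  simp [evalApprox, LinearMap.sum_apply]

theorem evalApprox_succ_sub_mem {f : V → CompletePathAlgebra k V}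
    {x : Arrow V → CompletePathAlgebra k V} (hx : ∀ α, x α ∈ lengthFiltration k V 1)
    (n : ℕ) (h : CompletePathAlgebra k V) :
    evalApprox f x (n + 1) h - evalApprox f x n h ∈ lengthFiltration k V n := by
  induction n generalizing h with
  | zero => exact mem_lengthFiltration_zero _
  | succ n ih =>
    rw [evalApprox_succ f x (n + 1), evalApprox_succ f x n, add_sub_add_left_eq_sub,
      ← Finset.sum_sub_distrib]
    refine sum_mem fun α _ => ?_
    rw [← sub_mul]
    exact mul_mem_lengthFiltration (ih _) (hx α)

theorem exists_linearMap_eval {f : V → CompletePathAlgebra k V}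
    {x : Arrow V → CompletePathAlgebra k V} (hx : ∀ α, x α ∈ lengthFiltration k V 1) :
    ∃ φ : CompletePathAlgebra k V →ₗ[k] CompletePathAlgebra k V,
      ∀ h, φ h = ∑ i, constCoeff i h • f i + ∑ α, φ (rightDeriv α h) * x α := by
  choose φ hφ using fun h => exists_limit (fun n => evalApprox f x n h)
    fun n => evalApprox_succ_sub_mem hx n h
  refine ⟨{ toFun := φ, map_add' := fun g h => ?_, map_smul' := fun c h => ?_ }, fun h => ?_⟩
  · refine sub_eq_zero.1 (eq_zero_of_forall_mem_lengthFiltration fun n => ?_)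
    have := sub_mem (hφ (g + h) n) (add_mem (hφ g n) (hφ h n))
    rw [map_add] at this
    convert this using 1
    abel
  · refine sub_eq_zero.1 (eq_zero_of_forall_mem_lengthFiltration fun n => ?_)
    have := sub_mem (hφ (c • h) n) (Submodule.smul_mem _ c (hφ h n))
    rw [map_smul, smul_sub] at this
    convert this using 1
    rw [RingHom.id_apply]
    abel
  · refine sub_eq_zero.1 (eq_zero_of_forall_mem_lengthFiltration fun n => ?_)
    have h1 := lengthFiltration_antitone n.le_succ (hφ h (n + 1))
    have h2 : ∑ α, (φ (rightDeriv α h) - evalApprox f x n (rightDeriv α h)) * x α ∈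
        lengthFiltration k V n := sum_mem fun α _ =>
      lengthFiltration_antitone n.le_succ (mul_mem_lengthFiltration (hφ _ n) (hx α))
    convert sub_mem h1 h2 using 1
    simp only [evalApprox_succ, sub_mul, Finset.sum_sub_distrib, LinearMap.coe_mk, AddHom.coe_mk]
    abel

/-- The universal property: complete orthogonal idempotents `f i` and elements `x α` without
constant term, with `x α` fixed by right multiplication with the idempotent at the target of `α`,
define an endomorphism. The recursion determines it: it sends the trivial path at `i` to `f i`, and
the arrow `α` with source `i` to `f i * x α`. -/
theorem exists_algHom_eval {f : V → CompletePathAlgebra k V}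
    {x : Arrow V → CompletePathAlgebra k V} (hf : CompleteOrthogonalIdempotents f)
    (hx : ∀ α, x α ∈ lengthFiltration k V 1) (hxf : ∀ α, x α * f α.2.1 = x α) :
    ∃ φ : CompletePathAlgebra k V →ₐ[k] CompletePathAlgebra k V,
      ∀ h, φ h = ∑ i, constCoeff i h • f i + ∑ α, φ (rightDeriv α h) * x α := by
  classical
  obtain ⟨φ, hφ⟩ := exists_linearMap_eval (f := f) hx
  have hxf' : ∀ α i, x α * f i = if i = α.2.1 then x α else 0 := by
    intro α i
    split_ifs with h
    · rw [h, hxf]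
    · rw [← hxf α, mul_assoc, hf.ortho (Ne.symm h), mul_zero]
  have hφf : ∀ h i, φ h * f i =
      constCoeff i h • f i + ∑ α, if i = α.2.1 then φ (rightDeriv α h) * x α else 0 := by
    intro h i
    rw [hφ h, add_mul, Finset.sum_mul, Finset.sum_mul]
    congr 1
    · rw [Finset.sum_eq_single i]
      · rw [smul_mul_assoc, (hf.idem i).eq]
      · intro j _ hj
        rw [smul_mul_assoc, hf.ortho hj, smul_zero]
      · simp
    · refine Finset.sum_congr rfl fun α _ => ?_
      rw [mul_assoc, hxf', mul_ite, mul_zero]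
  -- the defect of multiplicativity satisfies a recursion that raises the length
  have hrec : ∀ g h, φ (g * h) - φ g * φ h =
      ∑ α, (φ (g * rightDeriv α h) - φ g * φ (rightDeriv α h)) * x α := by
    intro g h
    have h1 : φ g * φ h = ∑ i, constCoeff i h • (φ g * f i) +
        ∑ α, φ g * φ (rightDeriv α h) * x α := by
      rw [hφ h, mul_add, Finset.mul_sum, Finset.mul_sum]
      simp only [mul_smul_comm, mul_assoc]
    have h2 : ∑ i, constCoeff i h • (φ g * f i) = ∑ i, constCoeff i (g * h) • f i +
        ∑ α, constCoeff α.2.1 h • (φ (rightDeriv α g) * x α) := by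
      simp only [hφf, smul_add, Finset.smul_sum, Finset.sum_add_distrib, smul_ite, smul_zero]
      congr 1
      · refine Finset.sum_congr rfl fun i _ => ?_
        rw [smul_smul, map_mul, mul_comm]
      · rw [Finset.sum_comm]
        simp
    rw [h1, h2, hφ (g * h)]
    simp only [rightDeriv_mul, map_add, map_smul, add_mul, sub_mul, smul_mul_assoc,
      Finset.sum_add_distrib, Finset.sum_sub_distrib]
    abel
  have hmul : ∀ g h, φ (g * h) = φ g * φ h := by
    intro g h
    refine sub_eq_zero.1 (eq_zero_of_forall_mem_lengthFiltration fun n => ?_)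
    induction n generalizing h with
    | zero => exact mem_lengthFiltration_zero _
    | succ n ih =>
      rw [hrec]
      exact sum_mem fun α _ => mul_mem_lengthFiltration (ih _) (hx α)
  have hone : φ 1 = 1 := by
    rw [hφ]
    simpa using hf.complete
  exact ⟨AlgHom.ofLinearMap φ hone hmul, hφ⟩

end Hom

/-! ### Lifting along surjections with kernel between two steps of the filtration -/

section Lift

variable {k : Type w} [Field k] {V : Type u} [Quiver.{v} V]
  {B : Type*} [Ring B] [Algebra k B] {π : CompletePathAlgebra k V →ₐ[k] B}

/-- Lifting of idempotents. If `s i` are arbitrary lifts of the given idempotents, their constant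
parts `E i` are already complete orthogonal idempotents, and conjugating them by the unit
`∑ i, E i * s i` moves them to lifts. -/
theorem exists_completeOrthogonalIdempotents_lift {ι : Type*} [Fintype ι]
    (hπ : Function.Surjective π) (hker : ∀ f, π f = 0 → f ∈ lengthFiltration k V 1)
    {g : ι → B} (hg : CompleteOrthogonalIdempotents g) :
    ∃ f : ι → CompletePathAlgebra k V, CompleteOrthogonalIdempotents f ∧ ∀ i, π (f i) = g i := by
  classical
  choose s hs using fun i => hπ (g i)
  have hcc : ∀ {a b : CompletePathAlgebra k V}, π a = π b →
      ∀ v, constCoeff v a = constCoeff v b := by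
    intro a b hab v
    have := mem_lengthFiltration_one.1 (hker (a - b) (by rw [map_sub, hab, sub_self])) v
    rwa [map_sub, sub_eq_zero] at this
  set E : ι → CompletePathAlgebra k V := fun i => diag fun v => constCoeff v (s i) with hE
  have hss : ∀ i v, constCoeff v (s i) * constCoeff v (s i) = constCoeff v (s i) := by
    intro i v
    rw [← map_mul]
    exact hcc (by rw [map_mul, hs, (hg.idem i).eq]) v
  have hEi : ∀ i, E i * E i = E i := fun i => by
    rw [hE, diag_mul]
    exact congrArg diag (funext fun v => hss i v)
  have hEo : ∀ i j, i ≠ j → E i * E j = 0 := fun i j hij => by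
    rw [hE, diag_mul, ← diag_zero]
    refine congrArg diag (funext fun v => ?_)
    change constCoeff v (s i) * constCoeff v (s j) = 0
    rw [← map_mul, ← map_zero (constCoeff v)]
    exact hcc (by rw [map_mul, hs, hs, hg.ortho hij, map_zero]) v
  have hsum : ∀ v, ∑ i, constCoeff v (s i) = 1 := fun v => by
    rw [← map_sum, ← map_one (constCoeff v)]
    exact hcc (by simp only [map_sum, hs, hg.complete, map_one]) v
  have hEc : ∑ i, E i = 1 := by
    refine ext_rightDeriv (fun v => ?_) fun α => ?_
    · simp only [hE, map_sum, constCoeff_diag, map_one, hsum]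
    · simp only [hE, map_sum, rightDeriv_diag, Finset.sum_const_zero]
      rw [rightDeriv_one]
  obtain ⟨u, hu⟩ : IsUnit (∑ i, E i * s i) := by
    refine isUnit_of_sub_one_mem (mem_lengthFiltration_one.2 fun v => ?_)
    simp only [map_sub, map_sum, map_mul, hE, constCoeff_diag, hss, hsum, map_one, sub_self]
  -- `u` intertwines `π (E j)` and `g j`
  have hint : ∀ j, π u * g j = π (E j) * π u := by
    intro j
    simp only [hu, map_sum, map_mul, hs, Finset.sum_mul, Finset.mul_sum]
    rw [Finset.sum_eq_single j, Finset.sum_eq_single j]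
    · rw [mul_assoc, (hg.idem j).eq, ← mul_assoc, ← map_mul, hEi]
    · intro i _ hij
      rw [← mul_assoc, ← map_mul, hEo j i hij.symm, map_zero, zero_mul]
    · simp
    · intro i _ hij
      rw [mul_assoc, hg.ortho hij, mul_zero]
    · simp
  refine ⟨fun i => ↑u⁻¹ * E i * u, CompleteOrthogonalIdempotents.iff_ortho_complete.2 ⟨?_, ?_⟩, ?_⟩
  · intro i j hij
    change ↑u⁻¹ * E i * u * (↑u⁻¹ * E j * u) = 0
    have : (↑u⁻¹ * E i * u * (↑u⁻¹ * E j * u) : CompletePathAlgebra k V) =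
        ↑u⁻¹ * (E i * E j) * u := by
      simp only [mul_assoc, Units.mul_inv_cancel_left]
    rw [this, hEo i j hij, mul_zero, zero_mul]
  · rw [← Finset.sum_mul, ← Finset.mul_sum, hEc, mul_one, Units.inv_mul]
  · intro i
    rw [map_mul, map_mul, mul_assoc, ← hint, ← mul_assoc, ← map_mul, Units.inv_mul, map_one,
      one_mul]

variable [Fintype V] [Fintype (Arrow V)]

/-- Every endomorphism of the quotient lifts. -/
theorem exists_algHom_lift (hπ : Function.Surjective π) {n : ℕ}
    (hn : ∀ f ∈ lengthFiltration k V n, π f = 0)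
    (hker : ∀ f, π f = 0 → f ∈ lengthFiltration k V 1) (σ : B →ₐ[k] B) :
    ∃ φ : CompletePathAlgebra k V →ₐ[k] CompletePathAlgebra k V, ∀ f, π (φ f) = σ (π f) := by
  obtain ⟨f, hf, hfπ⟩ := exists_completeOrthogonalIdempotents_lift hπ hker
    (completeOrthogonalIdempotents_vertex.map (σ.comp π).toRingHom)
  choose y hy using fun α => hπ (σ (π (arrow α)))
  -- arrows are nilpotent in `B`, hence so are their images, which forces constant terms to vanish
  have hy1 : ∀ α, y α ∈ lengthFiltration k V 1 := by
    intro α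
    refine mem_lengthFiltration_one.2 fun v => ?_
    have h0 : π (y α ^ n) = 0 := by
      rw [map_pow, hy, ← map_pow, ← map_pow,
        hn _ (pow_mem_lengthFiltration (arrow_mem_lengthFiltration α) n), map_zero]
    have h1 := mem_lengthFiltration_one.1 (hker _ h0) v
    rw [map_pow] at h1
    exact eq_zero_of_pow_eq_zero h1
  have hx1 : ∀ α, y α * f α.2.1 ∈ lengthFiltration k V 1 := fun α =>
    mul_mem_lengthFiltration (hy1 α) (mem_lengthFiltration_zero _)
  have hxπ : ∀ α, π (y α * f α.2.1) = σ (π (arrow α)) := by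
    intro α
    rw [map_mul, hy, hfπ]
    change σ (π (arrow α)) * σ (π (vertex α.2.1)) = _
    rw [← map_mul, ← map_mul, arrow_mul_vertex]
  obtain ⟨φ, hφ⟩ := exists_algHom_eval hf hx1
    fun α => by rw [mul_assoc, (hf.idem α.2.1).eq]
  refine ⟨φ, fun h => ?_⟩
  have hrec : ∀ h, π (φ h) - σ (π h) =
      ∑ α, (π (φ (rightDeriv α h)) - σ (π (rightDeriv α h))) * σ (π (arrow α)) := by
    intro h
    have h1 : σ (π h) = ∑ i, constCoeff i h • σ (π (vertex i)) +
        ∑ α, σ (π (rightDeriv α h)) * σ (π (arrow α)) := by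
      conv_lhs => rw [eq_sum_rightDeriv_mul_arrow h]
      simp only [map_add, map_sum, map_smul, map_mul]
    rw [h1, hφ h]
    simp only [map_add, map_sum, map_smul, map_mul π (φ _), hxπ, hfπ, sub_mul,
      Finset.sum_sub_distrib]
    exact add_sub_add_left_eq_sub _ _ _
  have hmem : ∀ m h, π (φ h) - σ (π h) ∈ (lengthFiltration k V m).map π.toLinearMap := by
    intro m
    induction m with
    | zero =>
      intro h
      obtain ⟨b, hb⟩ := hπ (π (φ h) - σ (π h))
      exact ⟨b, mem_lengthFiltration_zero _, hb⟩
    | succ m ih =>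
      intro h
      rw [hrec]
      refine sum_mem fun α _ => ?_
      obtain ⟨b, hb, hb'⟩ := ih (rightDeriv α h)
      refine ⟨b * (y α * f α.2.1), mul_mem_lengthFiltration hb (hx1 α), ?_⟩
      rw [← hxπ, ← hb']
      exact map_mul π _ _
  obtain ⟨b, hb, hb'⟩ := hmem n h
  rw [← sub_eq_zero, ← hb']
  exact hn b hb

/-- A lift of the identity is bijective: as the kernel of `π` consists of combinations of paths of
length at least `2`, it differs from the identity by a map raising the length of paths. -/
theorem bijective_of_lift_id (hker : ∀ f, π f = 0 → f ∈ lengthFiltration k V 2)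
    (θ : CompletePathAlgebra k V →ₐ[k] CompletePathAlgebra k V) (hθ : ∀ f, π (θ f) = π f) :
    Function.Bijective θ := by
  have h2 : ∀ f, θ f - f ∈ lengthFiltration k V 2 := fun f =>
    hker _ (by rw [map_sub, hθ, sub_self])
  refine bijective_of_sub_mem θ.toRingHom.toAddMonoidHom fun n => ?_
  change ∀ f ∈ lengthFiltration k V n, θ f - f ∈ lengthFiltration k V (n + 1)
  induction n with
  | zero => exact fun f _ => lengthFiltration_antitone one_le_two (h2 f)
  | succ n ih =>
    intro f hf
    have hf0 : ∀ i, constCoeff i f = 0 :=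
      mem_lengthFiltration_one.1 (lengthFiltration_antitone (by omega) hf)
    have hf1 : f = ∑ α, rightDeriv α f * arrow α := by
      conv_lhs => rw [eq_sum_rightDeriv_mul_arrow f]
      simp [hf0]
    rw [hf1, map_sum, ← Finset.sum_sub_distrib]
    refine sum_mem fun α _ => ?_
    have hd := rightDeriv_mem_lengthFiltration hf α
    have ha : θ (arrow α) ∈ lengthFiltration k V 1 := by
      have := add_mem (lengthFiltration_antitone one_le_two (h2 (arrow α)))
        (arrow_mem_lengthFiltration α)
      rwa [sub_add_cancel] at this
    have h3 : θ (rightDeriv α f * arrow α) - rightDeriv α f * arrow α =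
        (θ (rightDeriv α f) - rightDeriv α f) * θ (arrow α) +
          rightDeriv α f * (θ (arrow α) - arrow α) := by
      rw [map_mul, sub_mul, mul_sub]
      abel
    rw [h3]
    have h4 : rightDeriv α f * (θ (arrow α) - arrow α) ∈ lengthFiltration k V (n + 2) :=
      mul_mem_lengthFiltration hd (h2 _)
    exact add_mem (mul_mem_lengthFiltration (ih _ hd) ha) h4

/-- Every automorphism of the quotient lifts: lifts of an automorphism and of its inverse compose to
lifts of the identity. -/
theorem exists_algEquiv_lift (hπ : Function.Surjective π) {n : ℕ}
    (hn : ∀ f ∈ lengthFiltration k V n, π f = 0)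
    (hker : ∀ f, π f = 0 → f ∈ lengthFiltration k V 2) (σ : B ≃ₐ[k] B) :
    ∃ φ : CompletePathAlgebra k V ≃ₐ[k] CompletePathAlgebra k V, ∀ f, π (φ f) = σ (π f) := by
  have hker1 : ∀ f, π f = 0 → f ∈ lengthFiltration k V 1 := fun f hf =>
    lengthFiltration_antitone one_le_two (hker f hf)
  obtain ⟨φ, hφ⟩ := exists_algHom_lift hπ hn hker1 (σ : B →ₐ[k] B)
  obtain ⟨ψ, hψ⟩ := exists_algHom_lift hπ hn hker1 (σ.symm : B →ₐ[k] B)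
  have h1 := bijective_of_lift_id hker (φ.comp ψ) fun f => by simp [hφ, hψ]
  have h2 := bijective_of_lift_id hker (ψ.comp φ) fun f => by simp [hφ, hψ]
  have hb : Function.Bijective φ :=
    ⟨Function.Injective.of_comp (f := ψ) h2.1, Function.Surjective.of_comp (g := ψ) h1.2⟩
  exact ⟨AlgEquiv.ofBijective φ hb, hφ⟩

end Lift
end CompletePathAlgebra

/-! ### Subquotients of automorphism groups -/

/-- If all automorphisms of `B` lift along a surjection `A → B`, then those automorphisms of `A`
which descend to `B` form a subgroup of which the automorphism group of `B` is a quotient. -/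
theorem isSubquotient_of_forall_exists_lift {k A B : Type*} [CommRing k] [Ring A] [Algebra k A]
    [Ring B] [Algebra k B] (π : A →ₐ[k] B) (hπ : Function.Surjective π)
    (hlift : ∀ σ : B ≃ₐ[k] B, ∃ φ : A ≃ₐ[k] A, ∀ f, π (φ f) = σ (π f)) :
    IsSubquotient (B ≃ₐ[k] B) (A ≃ₐ[k] A) := by
  let K : Subgroup (A ≃ₐ[k] A) :=
    { carrier := {φ | ∃ σ : B ≃ₐ[k] B, ∀ f, π (φ f) = σ (π f)}
      one_mem' := ⟨1, fun _ => rfl⟩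
      mul_mem' := by
        rintro φ ψ ⟨σ, hσ⟩ ⟨τ, hτ⟩
        exact ⟨σ * τ, fun f => by simp only [AlgEquiv.mul_apply, hσ, hτ]⟩
      inv_mem' := by
        rintro φ ⟨σ, hσ⟩
        refine ⟨σ⁻¹, fun f => σ.injective ?_⟩
        rw [← hσ, ← AlgEquiv.mul_apply, ← AlgEquiv.mul_apply, mul_inv_cancel, mul_inv_cancel]
        rfl }
  choose r hr using fun φ : K => φ.2
  have huniq : ∀ {σ τ : B ≃ₐ[k] B}, (∀ f, σ (π f) = τ (π f)) → σ = τ := fun h =>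
    AlgEquiv.ext fun b => by
      obtain ⟨f, rfl⟩ := hπ b
      exact h f
  let R : K →* (B ≃ₐ[k] B) := MonoidHom.mk' r fun φ ψ => huniq fun f => by
    rw [← hr, AlgEquiv.mul_apply, ← hr, ← hr]
    rfl
  have hR : Function.Surjective R := fun σ => by
    obtain ⟨φ, hφ⟩ := hlift σ
    exact ⟨⟨φ, σ, hφ⟩, huniq fun f => by rw [← hφ]; exact (hr ⟨φ, σ, hφ⟩ f).symm⟩
  exact ⟨K, R.ker, inferInstance, ⟨(QuotientGroup.quotientKerEquivOfSurjective R hR).symm⟩⟩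

/-! ### Path algebras of finite quivers -/

theorem finite_setOf_length_lt (V : Type u) [Quiver.{v} V] [Finite V] [Finite (Arrow V)] (n : ℕ) :
    {x : Σ a b : V, Path a b | x.2.2.length < n}.Finite := by
  classical
  induction n with
  | zero => simp
  | succ n ih =>
    let F : (Σ a b : V, Path a b) × Arrow V → Σ a b : V, Path a b := fun z =>
      if h : z.1.2.1 = z.2.1 then ⟨z.1.1, z.2.2.1, Path.cons (h ▸ z.1.2.2) z.2.2.2⟩ else z.1
    refine ((Set.finite_range fun a : V => (⟨a, a, Path.nil⟩ : Σ a b : V, Path a b)).union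
      ((ih.prod (Set.finite_univ (α := Arrow V))).image F)).subset ?_
    rintro ⟨a, b, p⟩ hp
    cases p with
    | nil => exact Or.inl ⟨a, rfl⟩
    | @cons c _ p e =>
      refine Or.inr ⟨(⟨a, c, p⟩, ⟨c, b, e⟩), ⟨?_, Set.mem_univ _⟩, by simp [F]⟩
      simpa using hp

/-- In an acyclic quiver the number of vertices with a path to a given vertex grows along each
arrow, which bounds the length of paths. -/
theorem IsAcyclic.length_lt {V : Type u} [Quiver.{v} V] [Finite V] (hV : IsAcyclic V) {a b : V}
    (p : Path a b) : p.length < Nat.card V + 1 := by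
  let s : V → Set V := fun b => {a | Nonempty (Path a b)}
  have hlen : ∀ {a b : V} (p : Path a b), p.length ≤ (s b).ncard := by
    intro a b p
    induction p with
    | nil => exact Nat.zero_le _
    | @cons c d p e ih =>
      refine Nat.succ_le_of_lt (ih.trans_lt (Set.ncard_lt_ncard ?_))
      refine (Set.ssubset_iff_of_subset fun x hx => hx.map fun q => q.cons e).2
        ⟨d, ⟨Path.nil⟩, fun hd => ?_⟩
      obtain ⟨q⟩ := hd
      simpa using hV d (q.cons e)
  exact Nat.lt_succ_of_le ((hlen p).trans (Set.ncard_le_card _))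

theorem IsAcyclic.pathSubalgebra_eq_top {k : Type w} [CommRing k] {V : Type u} [Quiver.{v} V]
    [Finite V] [Finite (Arrow V)] (hV : IsAcyclic V) : pathSubalgebra k V = ⊤ :=
  top_le_iff.1 fun _ _ =>
    (finite_setOf_length_lt V (Nat.card V + 1)).subset fun x _ => hV.length_lt x.2.2

/-- Truncation of an element of the complete path algebra: discard the paths of length at least
`n`. -/
noncomputable def trunc (k : Type w) [CommRing k] (V : Type u) [Quiver.{v} V] [Finite V]
    [Finite (Arrow V)] (n : ℕ) : CompletePathAlgebra k V →ₗ[k] PathAlgebra k V where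
  toFun f := ⟨fun a b p => if p.length < n then f a b p else 0,
    (finite_setOf_length_lt V n).subset fun x hx => by
      by_contra h
      exact hx (if_neg h)⟩
  map_add' f g := Subtype.ext <| CompletePathAlgebra.ext' fun a b p => by
    change (if p.length < n then f a b p + g a b p else 0) =
      (if p.length < n then f a b p else 0) + (if p.length < n then g a b p else 0)
    split_ifs <;> simp
  map_smul' c f := Subtype.ext <| CompletePathAlgebra.ext' fun a b p => by
    change (if p.length < n then c * f a b p else 0) = c * (if p.length < n then f a b p else 0)
    split_ifs <;> simp

section Quotient

open CompletePathAlgebra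

variable {k : Type w} [CommRing k] {V : Type u} [Quiver.{v} V] [Finite V] [Finite (Arrow V)]

theorem trunc_sub_mem (n : ℕ) (f : CompletePathAlgebra k V) :
    (trunc k V n f : CompletePathAlgebra k V) - f ∈ lengthFiltration k V n := by
  intro a b p hp
  change (if p.length < n then f a b p else 0) - f a b p = 0
  rw [if_pos hp, sub_self]

theorem mk_trunc_eq (I : Ideal (PathAlgebra k V)) [I.IsTwoSided] {n : ℕ}
    (hI : ∀ f : PathAlgebra k V, LengthGE n f → f ∈ I) {f : CompletePathAlgebra k V}
    {g : PathAlgebra k V} (h : f - g ∈ lengthFiltration k V n) :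
    Ideal.Quotient.mkₐ k I (trunc k V n f) = Ideal.Quotient.mkₐ k I g :=
  Ideal.Quotient.eq.2 (hI _ (by
    have := add_mem (trunc_sub_mem n f) h
    rwa [sub_add_sub_cancel] at this))

/-- The projection of the complete path algebra onto the quotient of the path algebra by an ideal
containing all long paths: truncate, then reduce modulo the ideal. -/
noncomputable def quotientMap (I : Ideal (PathAlgebra k V)) [I.IsTwoSided] {n : ℕ}
    (hI : ∀ f : PathAlgebra k V, LengthGE n f → f ∈ I) :
    CompletePathAlgebra k V →ₐ[k] PathAlgebra k V ⧸ I :=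
  AlgHom.ofLinearMap ((Ideal.Quotient.mkₐ k I).toLinearMap ∘ₗ trunc k V n)
    (mk_trunc_eq I hI (g := 1) (by rw [OneMemClass.coe_one, sub_self]; exact zero_mem _))
    (fun f g => by
      refine (mk_trunc_eq I hI (f := f * g) (g := trunc k V n f * trunc k V n g) ?_).trans
        (map_mul _ _ _)
      have h1 := mul_mem_lengthFiltration (trunc_sub_mem n f)
        (mem_lengthFiltration_zero (trunc k V n g : CompletePathAlgebra k V))
      have h2 := mul_mem_lengthFiltration (mem_lengthFiltration_zero f) (trunc_sub_mem n g)
      rw [zero_add] at h2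
      have h3 := neg_mem (add_mem h1 h2)
      rw [sub_mul, mul_sub, sub_add_sub_cancel, neg_sub] at h3
      exact h3)

theorem quotientMap_surjective (I : Ideal (PathAlgebra k V)) [I.IsTwoSided] {n : ℕ}
    (hI : ∀ f : PathAlgebra k V, LengthGE n f → f ∈ I) :
    Function.Surjective (quotientMap I hI) := fun b => by
  obtain ⟨g, rfl⟩ := Ideal.Quotient.mkₐ_surjective k I b
  exact ⟨g, mk_trunc_eq I hI (by rw [sub_self]; exact zero_mem _)⟩

theorem quotientMap_eq_zero_of_mem (I : Ideal (PathAlgebra k V)) [I.IsTwoSided] {n : ℕ}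
    (hI : ∀ f : PathAlgebra k V, LengthGE n f → f ∈ I) {f : CompletePathAlgebra k V}
    (hf : f ∈ lengthFiltration k V n) : quotientMap I hI f = 0 :=
  (mk_trunc_eq I hI (g := 0) (by simpa using hf)).trans (map_zero _)

theorem mem_lengthFiltration_of_quotientMap_eq_zero (I : Ideal (PathAlgebra k V)) [I.IsTwoSided]
    {n : ℕ} (hI : ∀ f : PathAlgebra k V, LengthGE n f → f ∈ I) {m : ℕ} (hmn : m ≤ n)
    (hm : ∀ f ∈ I, LengthGE m f) {f : CompletePathAlgebra k V} (hf : quotientMap I hI f = 0) :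
    f ∈ lengthFiltration k V m := by
  have h1 : (trunc k V n f : CompletePathAlgebra k V) ∈ lengthFiltration k V m :=
    hm _ (Ideal.Quotient.eq_zero_iff_mem.1 hf)
  have := sub_mem h1 (lengthFiltration_antitone hmn (trunc_sub_mem n f))
  rwa [sub_sub_cancel] at this

end Quotient

end PathAlg

theorem theorem5p21 {k : Type*} [Field k] {V : Type*} [Quiver V] [Finite V]
    [∀ a b : V, Finite (a ⟶ b)] (I : Ideal (PathAlg.PathAlgebra k V)) [I.IsTwoSided]
    (hI : PathAlg.IsAdmissible I) :
    PathAlg.IsSubquotient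
        ((PathAlg.PathAlgebra k V ⧸ I) ≃ₐ[k] (PathAlg.PathAlgebra k V ⧸ I))
        (PathAlg.CompletePathAlgebra k V ≃ₐ[k] PathAlg.CompletePathAlgebra k V) ∧
      (PathAlg.IsAcyclic V →
        PathAlg.IsSubquotient
          ((PathAlg.PathAlgebra k V ⧸ I) ≃ₐ[k] (PathAlg.PathAlgebra k V ⧸ I))
          (PathAlg.PathAlgebra k V ≃ₐ[k] PathAlg.PathAlgebra k V)) := by
  obtain ⟨n, hn2, hn, h2⟩ := hI
  have := Fintype.ofFinite V
  have := Fintype.ofFinite (PathAlg.Arrow V)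
  have hlift := PathAlg.CompletePathAlgebra.exists_algEquiv_lift
    (PathAlg.quotientMap_surjective I hn)
    (fun _ hf => PathAlg.quotientMap_eq_zero_of_mem I hn hf)
    (fun _ hf => PathAlg.mem_lengthFiltration_of_quotientMap_eq_zero I hn hn2 h2 hf)
  refine ⟨PathAlg.isSubquotient_of_forall_exists_lift _ (PathAlg.quotientMap_surjective I hn) hlift,
    fun hV => ?_⟩
  let e : PathAlg.PathAlgebra k V ≃ₐ[k] PathAlg.CompletePathAlgebra k V :=
    (Subalgebra.equivOfEq _ _ hV.pathSubalgebra_eq_top).trans Subalgebra.topEquiv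
  refine PathAlg.isSubquotient_of_forall_exists_lift
    ((PathAlg.quotientMap I hn).comp e.toAlgHom)
    ((PathAlg.quotientMap_surjective I hn).comp e.surjective) fun σ => ?_
  obtain ⟨φ, hφ⟩ := hlift σ
  exact ⟨(e.trans φ).trans e.symm, fun f => by simp [hφ]⟩
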